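/- **Setting.** Let $X$ be a finite set of designs. The objective $f:X\to\mathbb R$ and the constraints $c_1,\dots,c_K:X\to\mathbb R$ ($K\ge 0$) are random functions drawn from mutually independent Gaussian process priors with means $\mu_y^0,\mu_k^0$ and (strictly) positive definite kernels $k_y^0,k_k^0$ on $X$. Designs $x^1,x^2,\dots$ are chosen sequentially by any nonanticipating, possibly randomised, rule (each $x^{n+1}$ is a measurable function of the designs and observations so far and of a random seed that is independent of everything else; maximising the current cKG is such a rule). Sampling $x^{n}$ returns $y^{n}=f(x^{n})+\epsilon_n$, with i.i.d. $\epsilon_n\sim N(0,\sigma_\epsilon^2)$, $\sigma_\epsilon^2\ge 0$, independent of $f$ and the $c_k$, and the exact values $c_1(x^{n}),\dots,c_K(x^{n})$. Let $\mu_y^n,k_y^n$ be the Gaussian process posterior mean and covariance of $f$ after $n$ samples, $$\mu_y^n(x)=\mu_y^0(x)+k_y^0(x,D)\big(k_y^0(D,D)+\sigma_\epsilon^2 I\big)^{-1}(Y-\mu_y^0(D)),\qquad k_y^n(x,x')=k_y^0(x,x')-k_y^0(x,D)\big(k_y^0(D,D)+\sigma_\epsilon^2 I\big)^{-1}k_y^0(D,x'),$$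 where $D$ lists the sampled designs and $Y$ the observations, and let $\mu_k^n,k_k^n$ be those of $c_k$, by the same formulas with noise variance $0$ (without noise, repeated designs are listed once). For a belief $(\mu_y,k_y,(\mu_k,k_k)_{k\le K})$ put $\mathrm{PF}(x)=\prod_{k=1}^K \mathbb P[N(\mu_k(x),k_k(x,x))\le 0]$, where $N(\mu,0)$ is the point mass at $\mu$. Let $x_r$ be a maximiser of $\mu_y\,\mathrm{PF}$, and let $Z_y,Z_1,\dots,Z_K$ be independent standard normal variables. For $x\in X$ let $$\mu_y'(x')=\mu_y(x')+\tilde\sigma_y(x',x)Z_y,\quad \mu_k'(x')=\mu_k(x')+\tilde\sigma_k(x',x)Z_k,\quad k_k'(x',x')=k_k(x',x')-\tilde\sigma_k(x',x)^2,$$ $$\tilde\sigma_y(x',x)=\frac{k_y(x',x)}{\sqrt{k_y(x,x)+\sigma_\epsilon^2}},\qquad \tilde\sigma_k(x',x)=\frac{k_k(x',x)}{\sqrt{k_k(x,x)}}\qquad(0/0=0),$$ let $\mathrm{PF}'$ be the probability of feasibility formed with $\mu_k',k_k'$, and define $$\mathrm{cKG}(x)=\mathbb E\Big[\max_{x'\in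 X}\mu_y'(x')\,\mathrm{PF}'(x')-\mu_y'(x_r)\,\mathrm{PF}'(x_r)\Big].$$ **Theorem.** Almost surely, the pointwise limits $\mu_y^\infty,k_y^\infty,\mu_k^\infty,k_k^\infty$ of the posterior means and covariances exist, $\mathrm{PF}^n(x)\to\mathrm{PF}^\infty(x)$ for all $x\in X$ (with $\mathrm{PF}^n$, $\mathrm{PF}^\infty$ formed from the $n$-th and from the limiting belief), and the following holds. Let $F=\{x\in X: c_k(x)\le 0,\ 1\le k\le K\}$. If $F\neq\emptyset$ and, for some maximiser $x_r$ of $\mu_y^\infty\,\mathrm{PF}^\infty$, the cKG of the limiting belief satisfies $\mathrm{cKG}(x)=0$ for all $x\in X$, then $$\operatorname*{arg\,max}_{x\in X}\ \mu_y^\infty(x)\,\mathrm{PF}^\infty(x)=\operatorname*{arg\,max}_{x\in X}\ f(x)\,\mathbb I_{x\in F}$$ as sets of maximisers; moreover, for all sufficiently large $n$, every recommended design $x_r^n\in\arg\max_{x}\mu_y^n(x)\,\mathrm{PF}^n(x)$ belongs to $\arg\max_{x}f(x)\,\mathbb I_{x\in F}$. -/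

import Mathlib

open MeasureTheory ProbabilityTheory Filter Topology
open scoped NNReal

noncomputable section

namespace CKG

/-- A Gaussian belief about a real function on the design set `X`: its mean function and its
covariance function. -/
structure Belief (X : Type*) where
  /-- mean function -/
  mean : X → ℝ
  /-- covariance function -/
  cov : X → X → ℝ

/-- The Gaussian process posterior of a function with prior mean `m` and prior covariance `k`, given
observations `y i` of its value at the designs `d i`, with independent `N(0, v)` noise:
mean `m(x) + k(x,D) (k(D,D) + v I)⁻¹ (y - m(D))`,
covariance `k(x,x') - k(x,D) (k(D,D) + v I)⁻¹ k(D,x')`. -/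
def gpPosterior {X ι : Type*} [Fintype ι] [DecidableEq ι] (m : X → ℝ) (k : X → X → ℝ) (v : ℝ≥0)
    (d : ι → X) (y : ι → ℝ) : Belief X where
  mean x := m x + (fun i => k x (d i)) ⬝ᵥ
    (((Matrix.of fun i j => k (d i) (d j)) + (v : ℝ) • (1 : Matrix ι ι ℝ))⁻¹.mulVec
      fun i => y i - m (d i))
  cov x x' := k x x' - (fun i => k x (d i)) ⬝ᵥ
    (((Matrix.of fun i j => k (d i) (d j)) + (v : ℝ) • (1 : Matrix ι ι ℝ))⁻¹.mulVec
      fun i => k (d i) x')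

open Classical in
/-- The indices of the first `n` samples that enter the training set. With noise (`0 < v`) these are
all of them. Without noise a repeated observation of a design coincides with the first one, and the
training set, being a set of pairs (design, value), contains it only once. -/
def trainingSet {X : Type*} (v : ℝ≥0) (d : ℕ → X) (n : ℕ) : Finset ℕ :=
  (Finset.range n).filter fun i => 0 < v ∨ ∀ j < i, d j ≠ d i

/-- The posterior after the first `n` observations `y 0, …, y (n-1)` at `d 0, …, d (n-1)`. -/
def posterior {X : Type*} (m : X → ℝ) (k : X → X → ℝ) (v : ℝ≥0) (d : ℕ → X) (y : ℕ → ℝ)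
    (n : ℕ) : Belief X :=
  gpPosterior m k v (fun i : trainingSet v d n => d i) (fun i : trainingSet v d n => y i)

/-- `σ̃(x, x̂) = k(x, x̂) / √(k(x̂, x̂) + v)`, the factor by which the posterior mean at `x` moves when
`x̂` is sampled. (It is `0` if `k(x̂, x̂) + v = 0`, when the observation at `x̂` is already known.) -/
def sigmaTilde {X : Type*} (v : ℝ≥0) (b : Belief X) (x xhat : X) : ℝ :=
  b.cov x xhat / √(b.cov xhat xhat + v)

/-- The belief after one more observation at `xhat` whose standardised innovation is `z`. -/
def lookahead {X : Type*} (v : ℝ≥0) (b : Belief X) (xhat : X) (z : ℝ) : Belief X where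
  mean x := b.mean x + sigmaTilde v b x xhat * z
  cov x x' := b.cov x x' - sigmaTilde v b x xhat * sigmaTilde v b x' xhat

/-- Probability of feasibility `∏ₖ ℙ[cₖ(x) ≤ 0]` for independent `cₖ(x) ∼ N(μₖ(x), kₖ(x,x))`
(a Dirac mass when the variance is `0`). -/
def PF {X : Type*} {K : ℕ} (bc : Fin K → Belief X) (x : X) : ℝ :=
  ∏ k, (gaussianReal ((bc k).mean x) ((bc k).cov x x).toNNReal).real (Set.Iic 0)

/-- The posterior utility `μ_y(x) PF(x)`. -/
def utility {X : Type*} {K : ℕ} (b : Belief X) (bc : Fin K → Belief X) (x : X) : ℝ :=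
  b.mean x * PF bc x

/-- The set of maximisers of `g`. -/
def argmaxSet {X : Type*} (g : X → ℝ) : Set X := {x | ∀ x', g x' ≤ g x}

/-- The constrained knowledge gradient of sampling `xhat`, where `b` is the current belief about the
objective (noise variance `v`), `bc` the beliefs about the constraints (observed without noise), and
`xr` the currently recommended design:
`𝔼[max_{x'} μ_y^{n+1}(x') PF^{n+1}(x') - μ_y^{n+1}(xr) PF^{n+1}(xr) | x^{n+1} = xhat]`,
an expectation over independent standard normal `Z_y, Z_1, …, Z_K`. -/
def cKG {X : Type*} {K : ℕ} (v : ℝ≥0) (b : Belief X) (bc : Fin K → Belief X) (xr xhat : X) : ℝ :=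
  ∫ z : ℝ × (Fin K → ℝ),
    ((⨆ x', utility (lookahead v b xhat z.1) (fun k => lookahead 0 (bc k) xhat (z.2 k)) x') -
      utility (lookahead v b xhat z.1) (fun k => lookahead 0 (bc k) xhat (z.2 k)) xr)
    ∂((gaussianReal 0 1).prod (Measure.pi fun _ : Fin K => gaussianReal 0 1))

/-- The feasible set of the constraint functions `c`. -/
def feasible {X : Type*} {K : ℕ} (c : Fin K → X → ℝ) : Set X := {x | ∀ k, c k x ≤ 0}

end CKG

end

/-!
The constraints are observed without noise at finitely many designs, so their posteriors are
constant once every design that is ever sampled has been sampled; from then on they are exact at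
the sampled designs and have positive variance elsewhere (`exists_resolves_posterior_zero`). The
same holds for the objective if `v = 0`.

If `v > 0`, write the posterior covariance of the objective in information form,
`C = (k⁻¹ + N / v)⁻¹`, where `N` is the diagonal matrix of the numbers of observations. Then the
posterior mean is `f + C (E / v - k⁻¹ (f - m))`, where `E x` is the sum of the noise terms met at
`x` (`gpPosterior_information_form`). Let `A` be the set of designs sampled infinitely often. The
rows and columns of `C` at `A` tend to `0` like `1 / N`, and the remaining block converges to the
inverse of a positive definite matrix (`exists_tendsto_inv_add_diagonal`). So the posterior
converges, and is exact on `A` in the limit, as soon as the noise averages `E x / N x` vanish for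
`x ∈ A`. Although the sampling times of `x` depend on the data, they are predictable. Therefore the
sum of the noise terms at `x`, the `j`-th divided by `j`, is a martingale bounded in `L²`, and
Kronecker's lemma gives the law of large numbers (`ae_tendsto_average_of_predictable`). Apart
from this law, the convergence of the posterior is a statement about each sample path.

Now suppose that the cKG of the limiting belief vanishes everywhere, and let `x ∉ A` be a design not
known to be infeasible. With positive probability, sampling `x` reveals that `x` is feasible; given
such constraint values, the utility of `x` after the sample is an increasing affine function of the
standardised innovation `Z_y`. As `A` is nonempty, there is a design whose utility the sample does
not change. A vanishing cKG means that the recommended design still beats both almost surely. But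
its utility is affine in `Z_y` as well, so that it would have to increase and to be bounded below
(`not_ae_affine_bounds`), which is impossible. Hence every design is either in `A` or known to be
infeasible, and the limiting utility is `f` on the feasible set and `0` elsewhere
(`utility_eq_indicator_of_cKG_eq_zero`). Since `X` is finite and the utilities converge, the
recommended designs are eventually among its maximisers.
-/

noncomputable section

namespace CKG

/-! ### Noise-free posteriors -/

/-- The belief `b` resolves the function `g` exactly on `A`: there it knows the values of `g`, with
zero covariance to every design, and elsewhere it is uncertain. Only the first argument of the
covariance ranges over `A`; this is the one in which the look-ahead mean is evaluated. -/
structure Resolves {X : Type*} (b : Belief X) (g : X → ℝ) (A : Set X) : Prop where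
  mean_eq : ∀ x ∈ A, b.mean x = g x
  cov_eq_zero : ∀ x ∈ A, ∀ x', b.cov x x' = 0
  cov_pos : ∀ x ∉ A, 0 < b.cov x x

/-- The regression on noise-free observations at distinct designs interpolates; elsewhere the
posterior variance is the value of the form `k` at a nonzero vector, a Schur complement. -/
theorem resolves_gpPosterior_zero {X ι : Type*} [Fintype X] [Fintype ι] [DecidableEq ι]
    {k : Matrix X X ℝ} (hk : k.PosDef) (m g : X → ℝ) {d : ι → X} (hd : Function.Injective d) :
    Resolves (gpPosterior m k 0 d fun i => g (d i)) g (Set.range d) := by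
  have hG : (k.submatrix d d).PosDef := hk.submatrix hd
  have hU : IsUnit (k.submatrix d d).det := (Matrix.isUnit_iff_isUnit_det _).mp hG.isUnit
  have hGe : ((Matrix.of fun i j => k (d i) (d j)) + ((0 : ℝ≥0) : ℝ) • (1 : Matrix ι ι ℝ)) =
      k.submatrix d d := by
    ext i j; simp
  have row : ∀ j, ∀ u : ι → ℝ,
      (fun i => k (d j) (d i)) ⬝ᵥ ((k.submatrix d d)⁻¹.mulVec u) = u j := by
    intro j u
    have : (k.submatrix d d).mulVec ((k.submatrix d d)⁻¹.mulVec u) = u := by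
      rw [Matrix.mulVec_mulVec, Matrix.mul_nonsing_inv _ hU, Matrix.one_mulVec]
    exact congrFun this j
  refine ⟨?_, ?_, ?_⟩
  · rintro _ ⟨j, rfl⟩
    simp only [gpPosterior, hGe]
    rw [row]; ring
  · rintro _ ⟨j, rfl⟩ x'
    simp only [gpPosterior, hGe]
    rw [row]; ring
  · intro x hx
    classical
    simp only [gpPosterior, hGe]
    set α : ι → ℝ := (k.submatrix d d)⁻¹.mulVec fun i => k (d i) x with hα
    have hαG : (k.submatrix d d).mulVec α = fun i => k (d i) x := by
      rw [hα, Matrix.mulVec_mulVec, Matrix.mul_nonsing_inv _ hU, Matrix.one_mulVec]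
    have hsym : ∀ a b, k a b = k b a := fun a b => by
      simpa using (hk.isHermitian.apply a b).symm
    -- the residual of `x` after regression on the sampled designs, as a weight vector
    set w : X → ℝ := Pi.single x 1 - ∑ i, α i • Pi.single (d i) (1 : ℝ) with hw
    have hwx : w x = 1 := by
      have : ∀ i, (Pi.single (d i) (1 : ℝ) : X → ℝ) x = 0 := fun i =>
        Pi.single_eq_of_ne (fun h => hx ⟨i, h.symm⟩) _
      simp [hw, this]
    have hpos := hk.dotProduct_mulVec_pos (x := w) (fun h => by simp [h] at hwx)
    have hkw : ∀ z, (k.mulVec w) z = k z x - ∑ i, α i * k z (d i) := by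
      intro z
      simp [hw, Matrix.mulVec_sub, Matrix.mulVec_sum, Matrix.mulVec_smul, Matrix.mulVec_single]
    have hzero : ∀ i, (k.mulVec w) (d i) = 0 := by
      intro i
      rw [hkw, ← congrFun hαG i]
      simp [Matrix.mulVec, dotProduct, mul_comm]
    have hdot : ∀ u : X → ℝ, star w ⬝ᵥ u = u x - ∑ i, α i * u (d i) := by
      intro u
      simp [hw, star_trivial, sub_dotProduct, sum_dotProduct]
    rw [hdot, Finset.sum_eq_zero fun i _ => by rw [hzero, mul_zero], sub_zero, hkw] at hpos
    simpa [dotProduct, mul_comm] using hpos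

/-- Without noise only first visits enter the training set, so that it is constant after the last
of the finitely many first visits. -/
theorem exists_trainingSet_eq {X : Type*} [Finite X] (d : ℕ → X) :
    ∃ N, ∀ n ≥ N, trainingSet 0 d n = trainingSet 0 d N ∧
      Set.range (fun i : trainingSet 0 d n => d i) = Set.range d := by
  classical
  set S : Set ℕ := {i | ∀ j < i, d j ≠ d i} with hS
  have hinj : Set.InjOn d S := by
    intro i hi j hj hij
    rcases lt_trichotomy i j with h | h | h
    · exact absurd hij (hj i h)
    · exact h
    · exact absurd hij.symm (hi j h)
  have hfin : S.Finite := Set.Finite.of_finite_image (Set.toFinite _) hinj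
  obtain ⟨N, hN⟩ := hfin.bddAbove
  have hmem : ∀ n ≥ N + 1, ∀ i, i ∈ trainingSet 0 d n ↔ i ∈ S := by
    intro n hn i
    simp only [trainingSet, Finset.mem_filter, Finset.mem_range, lt_self_iff_false, false_or]
    exact ⟨fun h => h.2, fun h => ⟨by have := hN h; omega, h⟩⟩
  refine ⟨N + 1, fun n hn => ⟨?_, ?_⟩⟩
  · ext i; rw [hmem n hn, hmem _ le_rfl]
  · ext x
    constructor
    · rintro ⟨i, rfl⟩; exact ⟨i, rfl⟩
    · rintro ⟨i, rfl⟩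
      have hex : ∃ j, d j = d i := ⟨i, rfl⟩
      refine ⟨⟨Nat.find hex, (hmem n hn _).2 fun j hj h => ?_⟩, Nat.find_spec hex⟩
      exact Nat.find_min hex hj (h.trans (Nat.find_spec hex))

theorem injective_trainingSet_zero {X : Type*} (d : ℕ → X) (n : ℕ) :
    Function.Injective fun i : trainingSet 0 d n => d i := by
  rintro ⟨i, hi⟩ ⟨j, hj⟩ hij
  simp only [trainingSet, Finset.mem_filter, lt_self_iff_false, false_or] at hi hj
  rcases lt_trichotomy i j with h | h | h
  · exact absurd hij (hj.2 i h)
  · exact Subtype.ext h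
  · exact absurd hij.symm (hi.2 j h)

theorem posterior_congr {X : Type*} (m : X → ℝ) (k : X → X → ℝ) {v : ℝ≥0} {d : ℕ → X}
    (y : ℕ → ℝ) {n n' : ℕ} (h : trainingSet v d n = trainingSet v d n') :
    posterior m k v d y n = posterior m k v d y n' := by
  unfold posterior
  rw [h]

/-- Noise-free posteriors are eventually constant, and the final one resolves the function exactly
at the visited designs. -/
theorem exists_resolves_posterior_zero {X : Type*} [Fintype X] {k : Matrix X X ℝ} (hk : k.PosDef)
    (m g : X → ℝ) (d : ℕ → X) {y : ℕ → ℝ} (hy : ∀ i, y i = g (d i)) :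
    ∃ b, (∀ᶠ n in atTop, posterior m k 0 d y n = b) ∧ Resolves b g (Set.range d) := by
  obtain ⟨N, hN⟩ := exists_trainingSet_eq d
  refine ⟨posterior m k 0 d y N, ?_, ?_⟩
  · filter_upwards [eventually_ge_atTop N] with n hn
    exact posterior_congr m k y (hN n hn).1
  · rw [← (hN N le_rfl).2]
    simp only [posterior, hy]
    exact resolves_gpPosterior_zero hk m g (injective_trainingSet_zero d N)

/-! ### What a vanishing cKG implies -/

variable {X : Type*} {K : ℕ}

theorem PF_nonneg (bc : Fin K → Belief X) (x : X) : 0 ≤ PF bc x :=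
  Finset.prod_nonneg fun _ _ => measureReal_nonneg

theorem PF_le_one (bc : Fin K → Belief X) (x : X) : PF bc x ≤ 1 :=
  Finset.prod_le_one (fun _ _ => measureReal_nonneg) fun _ _ => measureReal_le_one

theorem PF_eq_one_of_cov_eq_zero {bc : Fin K → Belief X} {x : X}
    (hcov : ∀ k, (bc k).cov x x = 0) (hmean : ∀ k, (bc k).mean x ≤ 0) : PF bc x = 1 := by
  refine Finset.prod_eq_one fun k _ => ?_
  rw [hcov, Real.toNNReal_zero, gaussianReal_zero_var]
  simp [measureReal_def, hmean k]

theorem PF_eq_zero_of_cov_eq_zero {bc : Fin K → Belief X} {x : X} {k : Fin K}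
    (hcov : (bc k).cov x x = 0) (hmean : 0 < (bc k).mean x) : PF bc x = 0 := by
  refine Finset.prod_eq_zero (Finset.mem_univ k) ?_
  rw [hcov, Real.toNNReal_zero, gaussianReal_zero_var]
  simp [measureReal_def, hmean]

theorem measurable_PF_lookahead (bc : Fin K → Belief X) (xhat x : X) :
    Measurable fun z : Fin K → ℝ => PF (fun k => lookahead 0 (bc k) xhat (z k)) x := by
  refine Finset.measurable_prod _ fun k _ => ?_
  have h : Measurable fun z : Fin K → ℝ =>
      gaussianReal ((lookahead 0 (bc k) xhat (z k)).mean x)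
        ((lookahead 0 (bc k) xhat (z k)).cov x x).toNNReal := by
    have hm : Measurable fun z : Fin K → ℝ => ((lookahead 0 (bc k) xhat (z k)).mean x,
        ((lookahead 0 (bc k) xhat (z k)).cov x x).toNNReal) := by
      simp only [lookahead]
      fun_prop
    exact measurable_gaussianReal.comp hm
  exact (Measure.measurable_measure.1 h _ measurableSet_Iic).ennreal_toReal

/-- The distribution of the standardised innovations `(Z_y, (Z_k)_k)`. -/
abbrev innovationLaw (K : ℕ) : Measure (ℝ × (Fin K → ℝ)) :=
  (gaussianReal 0 1).prod (Measure.pi fun _ : Fin K => gaussianReal 0 1)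

theorem integrable_utility_lookahead (v : ℝ≥0) (b : Belief X) (bc : Fin K → Belief X)
    (xhat x : X) :
    Integrable (fun z : ℝ × (Fin K → ℝ) =>
      utility (lookahead v b xhat z.1) (fun k => lookahead 0 (bc k) xhat (z.2 k)) x)
      (innovationLaw K) := by
  have hid : Integrable (fun z : ℝ => z) (gaussianReal 0 1) :=
    (memLp_id_gaussianReal 1).integrable le_rfl
  have h1 : Integrable (fun z : ℝ × (Fin K → ℝ) => (lookahead v b xhat z.1).mean x)
      (innovationLaw K) := by
    have : Integrable (fun z : ℝ => (lookahead v b xhat z).mean x) (gaussianReal 0 1) :=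
      (integrable_const _).add (hid.const_mul _)
    exact this.comp_fst _
  refine h1.mul_bdd (c := 1)
    ((measurable_PF_lookahead bc xhat x).comp measurable_snd).aestronglyMeasurable ?_
  refine ae_of_all _ fun z => ?_
  rw [Real.norm_of_nonneg (PF_nonneg _ _)]
  exact PF_le_one _ _

/-- If the cKG of sampling `xhat` vanishes, then the recommended design remains optimal for almost
every outcome of the sample. -/
theorem ae_utility_le_of_cKG_eq_zero [Finite X] {v : ℝ≥0} {b : Belief X}
    {bc : Fin K → Belief X} {xr xhat : X} (h : cKG v b bc xr xhat = 0) :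
    ∀ᵐ z ∂innovationLaw K, ∀ x,
      utility (lookahead v b xhat z.1) (fun k => lookahead 0 (bc k) xhat (z.2 k)) x ≤
      utility (lookahead v b xhat z.1) (fun k => lookahead 0 (bc k) xhat (z.2 k)) xr := by
  cases nonempty_fintype X
  set u : ℝ × (Fin K → ℝ) → X → ℝ := fun z x =>
    utility (lookahead v b xhat z.1) (fun k => lookahead 0 (bc k) xhat (z.2 k)) x with hu
  have hint : ∀ x, Integrable (fun z => u z x) (innovationLaw K) :=
    integrable_utility_lookahead v b bc xhat
  have hle : ∀ z x, u z x ≤ ⨆ x', u z x' := fun z x => le_ciSup (Set.finite_range (u z)).bddAbove x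
  have hsup : Integrable (fun z => ⨆ x', u z x') (innovationLaw K) := by
    refine Integrable.mono' (integrable_finsetSum Finset.univ fun x _ => (hint x).abs) ?_ ?_
    · exact (AEMeasurable.iSup fun x => (hint x).aemeasurable).aestronglyMeasurable
    · refine ae_of_all _ fun z => ?_
      rw [Real.norm_eq_abs, abs_le]
      have hterm : ∀ x, |u z x| ≤ ∑ x', |u z x'| := fun x =>
        Finset.single_le_sum (f := fun x' => |u z x'|) (fun _ _ => abs_nonneg _) (Finset.mem_univ x)
      constructor
      · exact (abs_le.1 (hterm xr)).1.trans (hle z xr)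
      · have : Nonempty X := ⟨xr⟩
        exact ciSup_le fun x => (le_abs_self _).trans (hterm x)
  have h0 := (integral_eq_zero_iff_of_nonneg
    (fun z => sub_nonneg.2 (hle z xr)) (hsup.sub (hint xr))).1 h
  filter_upwards [h0] with z hz x
  have : (⨆ x', u z x') - u z xr = 0 := hz
  have := hle z x
  linarith

/-- No affine function of `z` stays above a constant and above an
increasing affine function at once. -/
theorem not_ae_affine_bounds {μ s p m σ κ : ℝ} (hσ : 0 < σ)
    (h1 : ∀ᵐ z ∂gaussianReal 0 1, κ ≤ (μ + s * z) * p)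
    (h2 : ∀ᵐ z ∂gaussianReal 0 1, m + σ * z ≤ (μ + s * z) * p) : False := by
  have hd : Dense {z : ℝ | κ ≤ (μ + s * z) * p ∧ m + σ * z ≤ (μ + s * z) * p} := by
    refine Measure.dense_of_ae (μ := volume) ?_
    exact (gaussianReal_absolutelyContinuous' 0 one_ne_zero).ae_le (h1.and h2)
  have hall : ∀ z : ℝ, κ ≤ (μ + s * z) * p ∧ m + σ * z ≤ (μ + s * z) * p := by
    have hcl : IsClosed {z : ℝ | κ ≤ (μ + s * z) * p ∧ m + σ * z ≤ (μ + s * z) * p} :=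
      IsClosed.and (isClosed_le (by fun_prop) (by fun_prop))
        (isClosed_le (by fun_prop) (by fun_prop))
    intro z
    have := hd.closure_eq
    rw [hcl.closure_eq] at this
    exact (this ▸ Set.mem_univ z : z ∈ {z : ℝ | _})
  -- the slope `s * p` would have to be at least `σ` and nonpositive
  have hsp : σ ≤ s * p := by
    by_contra! hlt
    have := (hall ((μ * p - m + 1) / (σ - s * p))).2
    have hne : σ - s * p ≠ 0 := by linarith
    have e : (σ - s * p) * ((μ * p - m + 1) / (σ - s * p)) = μ * p - m + 1 := by field_simp
    nlinarith
  have hpos : 0 < s * p := hσ.trans_le hsp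
  have := (hall ((κ - μ * p - 1) / (s * p))).1
  have e : s * p * ((κ - μ * p - 1) / (s * p)) = κ - μ * p - 1 := by
    rw [← mul_div_assoc, mul_div_cancel_left₀ _ hpos.ne']
  nlinarith

theorem measure_pi_Iic_ne_zero (t : Fin K → ℝ) :
    (Measure.pi fun _ : Fin K => gaussianReal 0 1) (Set.univ.pi fun k => Set.Iic (t k)) ≠ 0 := by
  rw [Measure.pi_pi]
  refine Finset.prod_ne_zero_iff.2 fun k _ => ?_
  intro h
  have := gaussianReal_absolutelyContinuous' 0 one_ne_zero h
  simp at this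

theorem sigmaTilde_zero_self (b : Belief X) (x : X) :
    sigmaTilde 0 b x x = √(b.cov x x) := by
  rw [sigmaTilde, NNReal.coe_zero, add_zero, Real.div_sqrt]

/-- The look-ahead probability of feasibility at the sampled design `x` is `1` for a set of
outcomes of positive probability, unless `x` is already known to be infeasible. -/
theorem exists_PF_lookahead_eq_one {bc : Fin K → Belief X} {c : Fin K → X → ℝ} {B : Set X}
    (hbc : ∀ k, Resolves (bc k) (c k) B) {x : X} (hx : x ∈ B → ∀ k, c k x ≤ 0) :
    ∃ t : Fin K → ℝ, ∀ z : Fin K → ℝ, (∀ k, z k ≤ t k) →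
      PF (fun k => lookahead 0 (bc k) x (z k)) x = 1 := by
  by_cases hB : x ∈ B
  · refine ⟨0, fun z _ => PF_eq_one_of_cov_eq_zero (fun k => ?_) fun k => ?_⟩
    · simp [lookahead, sigmaTilde, (hbc k).cov_eq_zero x hB]
    · simp [lookahead, sigmaTilde, (hbc k).cov_eq_zero x hB, (hbc k).mean_eq x hB, hx hB k]
  · have hpos := fun k => (hbc k).cov_pos x hB
    refine ⟨fun k => -(bc k).mean x / √((bc k).cov x x), fun z hz =>
      PF_eq_one_of_cov_eq_zero (fun k => ?_) fun k => ?_⟩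
    · simp only [lookahead, sigmaTilde_zero_self]
      rw [Real.mul_self_sqrt (hpos k).le, sub_self]
    · simp only [lookahead, sigmaTilde_zero_self]
      have := (le_div_iff₀ (Real.sqrt_pos.2 (hpos k))).1 (hz k)
      linarith

/-- If the cKG vanishes everywhere, every design outside `A` is known to be infeasible. -/
theorem mem_and_exists_pos_of_cKG_eq_zero [Finite X] {v : ℝ≥0} {b : Belief X}
    {bc : Fin K → Belief X} {f : X → ℝ} {c : Fin K → X → ℝ} {A B : Set X}
    (hb : Resolves b f A) (hbc : ∀ k, Resolves (bc k) (c k) B) (hA : A.Nonempty)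
    {xr : X} {x : X} (h : cKG v b bc xr x = 0) (hx : x ∉ A) :
    x ∈ B ∧ ∃ k, 0 < c k x := by
  by_contra hcon
  obtain ⟨a, ha⟩ := hA
  obtain ⟨t, ht⟩ := exists_PF_lookahead_eq_one hbc (x := x) (fun hB k => by
    by_contra! hk
    exact hcon ⟨hB, k, hk⟩)
  have hae := ae_utility_le_of_cKG_eq_zero h
  -- for almost every outcome of the constraints, the inequality holds for almost every `Z_y`
  have hae' := Measure.ae_ae_of_ae_prod ((Measure.measurePreserving_swap
    (μ := Measure.pi fun _ : Fin K => gaussianReal 0 1)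
    (ν := gaussianReal 0 1)).quasiMeasurePreserving.ae hae)
  obtain ⟨z, hz, hzt⟩ := (frequently_ae_mem_iff.2 (measure_pi_Iic_ne_zero t)).and_eventually hae'
    |>.exists
  have hone := ht z fun k => hz k trivial
  have hσ : 0 < sigmaTilde v b x x :=
    div_pos (hb.cov_pos x hx) (Real.sqrt_pos.2 (by have := hb.cov_pos x hx; positivity))
  refine not_ae_affine_bounds (μ := b.mean xr) (s := sigmaTilde v b xr x)
    (p := PF (fun k => lookahead 0 (bc k) x (z k)) xr) (m := b.mean x)
    (κ := f a * PF (fun k => lookahead 0 (bc k) x (z k)) a) hσ ?_ ?_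
  · filter_upwards [hzt] with w hw
    have := hw a
    simpa [utility, lookahead, sigmaTilde, hb.cov_eq_zero a ha, hb.mean_eq a ha] using this
  · filter_upwards [hzt] with w hw
    have := hw x
    simp only [utility, Prod.fst_swap, Prod.snd_swap, hone, mul_one] at this
    exact this

/-- If the cKG vanishes everywhere, the believed utility is the true one: `f` on the feasible set
and `0` elsewhere. -/
theorem utility_eq_indicator_of_cKG_eq_zero [Finite X] {v : ℝ≥0} {b : Belief X}
    {bc : Fin K → Belief X} {f : X → ℝ} {c : Fin K → X → ℝ} {A B : Set X}
    (hb : Resolves b f A) (hbc : ∀ k, Resolves (bc k) (c k) B) (hAB : A ⊆ B) (hA : A.Nonempty)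
    {xr : X} (h : ∀ x, cKG v b bc xr x = 0) :
    utility b bc = (feasible c).indicator f := by
  ext x
  have hB : x ∈ B := by
    by_cases hx : x ∈ A
    · exact hAB hx
    · exact (mem_and_exists_pos_of_cKG_eq_zero hb hbc hA (h x) hx).1
  have hcov := fun k => (hbc k).cov_eq_zero x hB x
  by_cases hF : x ∈ feasible c
  · have hx : x ∈ A := by
      by_contra hx
      obtain ⟨k, hk⟩ := (mem_and_exists_pos_of_cKG_eq_zero hb hbc hA (h x) hx).2
      exact hk.not_ge (hF k)
    rw [Set.indicator_of_mem hF, utility, hb.mean_eq x hx,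
      PF_eq_one_of_cov_eq_zero hcov fun k => ((hbc k).mean_eq x hB).trans_le (hF k), mul_one]
  · obtain ⟨k, hk⟩ := not_forall.1 hF
    rw [Set.indicator_of_notMem hF, utility, PF_eq_zero_of_cov_eq_zero (hcov k)
      (by rw [(hbc k).mean_eq x hB]; exact not_le.1 hk), mul_zero]

/-- On a finite set, maximisers of functions close to `g` are maximisers of `g`. -/
theorem eventually_argmaxSet_subset [Finite X] {u : ℕ → X → ℝ} {g : X → ℝ}
    (h : ∀ x, Tendsto (fun n => u n x) atTop (𝓝 (g x))) :
    ∀ᶠ n in atTop, argmaxSet (u n) ⊆ argmaxSet g := by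
  have : ∀ᶠ n in atTop, ∀ x x', g x < g x' → u n x < u n x' := by
    refine eventually_all.2 fun x => eventually_all.2 fun x' => ?_
    by_cases hlt : g x < g x'
    · filter_upwards [(h x).eventually_lt (h x') hlt] with n hn _ using hn
    · exact Eventually.of_forall fun _ h => absurd h hlt
  filter_upwards [this] with n hn x hx x'
  by_contra! hlt
  exact (hn x x' hlt).not_ge (hx x')

/-! ### Limits of noisy posteriors -/

section NoisyPosterior

variable {X ι : Type*} [Fintype X] [DecidableEq X] [Fintype ι] [DecidableEq ι]

/-- The posterior covariance in information form, `C = (k⁻¹ + N / v)⁻¹`, and the posterior mean as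
truth plus error, for observations `f (d i) + e i`; `N` counts the observations of each design and
the errors enter through their sums. -/
theorem gpPosterior_information_form {k : Matrix X X ℝ} (hk : k.PosDef) (m f : X → ℝ) {v : ℝ≥0}
    (hv : 0 < v) (d : ι → X) (e : ι → ℝ) :
    let b := gpPosterior m k v d fun i => f (d i) + e i
    Matrix.of b.cov * (k⁻¹ + (v : ℝ)⁻¹ •
        Matrix.diagonal fun x => ∑ i, if d i = x then (1 : ℝ) else 0) = 1 ∧
      (∀ x, b.mean x = f x + ((Matrix.of b.cov).mulVec
        ((v : ℝ)⁻¹ • (fun z => ∑ i, if d i = z then e i else 0) - k⁻¹.mulVec (f - m))) x) ∧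
      ∀ x, b.cov x x ≤ k x x := by
  intro b
  have hv' : (v : ℝ) ≠ 0 := by positivity
  -- the incidence matrix of designs in observations
  set H : Matrix ι X ℝ := (1 : Matrix X X ℝ).submatrix d id with hH
  have hkH : k.submatrix id d = k * H.transpose := by
    ext x i; simp [hH, Matrix.mul_apply, Matrix.one_apply]
  have hHk : k.submatrix d id = H * k := by
    ext i x; simp [hH, Matrix.mul_apply, Matrix.one_apply]
  have hHkH : (Matrix.of fun i j => k (d i) (d j)) = H * k * H.transpose := by
    rw [← hHk]
    ext i x; simp [hH, Matrix.mul_apply, Matrix.one_apply]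
  have hD : H.transpose * H = Matrix.diagonal fun x => ∑ i, if d i = x then (1 : ℝ) else 0 := by
    ext x z
    rw [Matrix.mul_apply, Matrix.diagonal_apply]
    split_ifs with h
    · subst h
      refine Finset.sum_congr rfl fun i _ => ?_
      by_cases hi : d i = x <;> simp [hH, hi, Matrix.one_apply]
    · refine Finset.sum_eq_zero fun i _ => ?_
      simp only [hH, Matrix.transpose_apply, Matrix.submatrix_apply, id, Matrix.one_apply]
      split_ifs with h1 h2 <;> simp
      exact h (h1.symm.trans h2)
  set G : Matrix ι ι ℝ := H * k * H.transpose + (v : ℝ) • 1 with hG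
  have hGpos : G.PosDef := by
    refine Matrix.PosDef.posSemidef_add ?_ (Matrix.PosDef.one.smul (by positivity))
    simpa using hk.posSemidef.mul_mul_conjTranspose_same H
  have hGu : IsUnit G.det := (Matrix.isUnit_iff_isUnit_det _).mp hGpos.isUnit
  have hku : IsUnit k.det := (Matrix.isUnit_iff_isUnit_det _).mp hk.isUnit
  have hcov : Matrix.of b.cov = k - k * H.transpose * (G⁻¹ * (H * k)) := by
    rw [← hkH, ← hHk, hG, ← hHkH]
    rfl
  have hGH : G⁻¹ * (H * k * H.transpose) = 1 - (v : ℝ) • G⁻¹ := by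
    have : H * k * H.transpose = G - (v : ℝ) • 1 := by rw [hG]; abel
    rw [this, mul_sub, Matrix.nonsing_inv_mul _ hGu, Matrix.mul_smul, mul_one]
  -- the gain matrix `k Hᵀ G⁻¹` in terms of the posterior covariance
  have hgain : (v : ℝ)⁻¹ • (Matrix.of b.cov * H.transpose) = k * H.transpose * G⁻¹ := by
    have : Matrix.of b.cov * H.transpose = (v : ℝ) • (k * H.transpose * G⁻¹) := by
      calc Matrix.of b.cov * H.transpose
          = k * H.transpose - k * H.transpose * (G⁻¹ * (H * k * H.transpose)) := by
            rw [hcov, Matrix.sub_mul]; simp only [Matrix.mul_assoc]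
        _ = _ := by rw [hGH, Matrix.mul_sub, Matrix.mul_one, Matrix.mul_smul]; abel
    rw [this, smul_smul, inv_mul_cancel₀ hv', one_smul]
  have hinfo : Matrix.of b.cov * (k⁻¹ + (v : ℝ)⁻¹ • (H.transpose * H)) = 1 := by
    have h1 : Matrix.of b.cov * k⁻¹ = 1 - k * H.transpose * G⁻¹ * H := by
      rw [hcov, sub_mul, Matrix.mul_nonsing_inv _ hku]
      simp only [Matrix.mul_assoc, Matrix.mul_nonsing_inv _ hku, Matrix.mul_one]
    rw [mul_add, Matrix.mul_smul, ← Matrix.mul_assoc, ← Matrix.smul_mul, hgain, h1]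
    abel
  refine ⟨hD ▸ hinfo, fun x => ?_, fun x => ?_⟩
  · have hmean : b.mean = m + (k * H.transpose * G⁻¹).mulVec (H.mulVec (f - m) + e) := by
      have hobs : (fun i => f (d i) + e i - m (d i)) = H.mulVec (f - m) + e := by
        ext i
        simp [hH, Matrix.mulVec, dotProduct, Matrix.one_apply]
        ring
      rw [← hobs, ← Matrix.mulVec_mulVec, ← hkH, hG, ← hHkH]
      rfl
    have hnoise : (fun z => ∑ i, if d i = z then e i else 0) = H.transpose.mulVec e := by
      ext z
      simp [hH, Matrix.mulVec, dotProduct, Matrix.one_apply]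
    have hE : (k * H.transpose * G⁻¹).mulVec e =
        (Matrix.of b.cov).mulVec ((v : ℝ)⁻¹ • H.transpose.mulVec e) := by
      rw [← hgain, Matrix.mulVec_smul, Matrix.mulVec_mulVec, Matrix.smul_mulVec]
    have hF : (k * H.transpose * G⁻¹).mulVec (H.mulVec (f - m)) =
        (f - m) - (Matrix.of b.cov).mulVec (k⁻¹.mulVec (f - m)) := by
      have h2 : k * H.transpose * G⁻¹ * H = 1 - Matrix.of b.cov * k⁻¹ := by
        rw [← hinfo, mul_add, Matrix.mul_smul, ← Matrix.mul_assoc, ← Matrix.smul_mul, hgain]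
        abel
      rw [Matrix.mulVec_mulVec, h2, Matrix.sub_mulVec, Matrix.one_mulVec, Matrix.mulVec_mulVec]
    rw [hmean, Matrix.mulVec_add, hE, hF, hnoise, Matrix.mulVec_sub (Matrix.of b.cov)]
    simp only [Pi.add_apply, Pi.sub_apply]
    ring
  · have hsym : (fun i => k x (d i)) = fun i => k (d i) x := by
      ext i
      simpa using hk.isHermitian.apply (d i) x
    have hnn : 0 ≤ (fun i => k x (d i)) ⬝ᵥ (G⁻¹.mulVec fun i => k (d i) x) := by
      rw [hsym]
      exact hGpos.inv.posSemidef.dotProduct_mulVec_nonneg _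
    have : b.cov x x = k x x - (fun i => k x (d i)) ⬝ᵥ (G⁻¹.mulVec fun i => k (d i) x) := by
      rw [hG, ← hHkH]
      rfl
    linarith

end NoisyPosterior

/-- The entries of a positive semidefinite matrix are bounded by its diagonal. -/
theorem abs_apply_le_of_posSemidef {X : Type*} [Finite X] {C : Matrix X X ℝ} (hC : C.PosSemidef)
    (x z : X) : |C x z| ≤ (C x x + C z z) / 2 := by
  classical
  cases nonempty_fintype X
  have hs : C z x = C x z := by simpa using hC.isHermitian.apply x z
  have h1 := hC.dotProduct_mulVec_nonneg (Pi.single x 1 + Pi.single z 1)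
  have h2 := hC.dotProduct_mulVec_nonneg (Pi.single x 1 - Pi.single z 1)
  simp [Matrix.mulVec_add, Matrix.mulVec_sub, Matrix.mulVec_single, add_dotProduct,
    sub_dotProduct, hs] at h1 h2
  rw [abs_le]
  constructor <;> linarith

/-- Limit of the posterior covariances `C n = (J + N n)⁻¹` when the information `N n x` collected
at `x` tends to infinity for `x ∈ A` and is eventually constant otherwise. -/
theorem exists_tendsto_inv_add_diagonal {X : Type*} [Fintype X] [DecidableEq X]
    {J : Matrix X X ℝ} (hJ : J.PosDef) {N : ℕ → X → ℝ} (hN : ∀ n x, 0 ≤ N n x)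
    {C : ℕ → Matrix X X ℝ} (hC : ∀ n, C n * (J + Matrix.diagonal (N n)) = 1)
    {R : X → ℝ} (hR : ∀ n x, C n x x ≤ R x) {A : Set X}
    (hA : ∀ x ∈ A, Tendsto (fun n => N n x) atTop atTop) {L : X → ℝ}
    (hL : ∀ x ∉ A, ∀ᶠ n in atTop, N n x = L x) :
    (∃ R' : X → X → ℝ, ∀ n x z, |C n x z * N n z| ≤ R' x z) ∧
    ∃ D : Matrix X X ℝ, (∀ x z, Tendsto (fun n => C n x z) atTop (𝓝 (D x z))) ∧
      (∀ x ∈ A, ∀ z, D x z = 0) ∧ (∀ x, ∀ z ∈ A, D x z = 0) ∧ ∀ x ∉ A, 0 < D x x := by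
  classical
  have hM : ∀ n, (J + Matrix.diagonal (N n)).PosDef := fun n =>
    hJ.add_posSemidef (Matrix.PosSemidef.diagonal (hN n))
  have hCpos : ∀ n, (C n).PosSemidef := fun n => by
    rw [← Matrix.inv_eq_left_inv (hC n)]
    exact (hM n).inv.posSemidef
  have hCb : ∀ n x z, |C n x z| ≤ (R x + R z) / 2 := fun n x z =>
    (abs_apply_le_of_posSemidef (hCpos n) x z).trans (by linarith [hR n x, hR n z])
  have hcol : ∀ n x z, (C n * J) x z + C n x z * N n z = (1 : Matrix X X ℝ) x z := by
    intro n x z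
    rw [← hC n, mul_add, Matrix.add_apply, Matrix.mul_diagonal]
  have hCN : ∀ n x z, |C n x z * N n z| ≤ 1 + ∑ y, (R x + R y) / 2 * |J y z| := by
    intro n x z
    have h1 : C n x z * N n z = (1 : Matrix X X ℝ) x z - (C n * J) x z := by
      linarith [hcol n x z]
    rw [h1]
    refine (abs_sub _ _).trans (add_le_add ?_ ?_)
    · rw [Matrix.one_apply]; split_ifs <;> simp
    · rw [Matrix.mul_apply]
      refine (Finset.abs_sum_le_sum_abs _ _).trans (Finset.sum_le_sum fun y _ => ?_)
      rw [abs_mul]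
      exact mul_le_mul_of_nonneg_right (hCb n x y) (abs_nonneg _)
  refine ⟨⟨_, hCN⟩, ?_⟩
  have hzero : ∀ x, ∀ z ∈ A, Tendsto (fun n => C n x z) atTop (𝓝 0) := by
    intro x z hz
    have h1 : Tendsto (fun n => (N n z)⁻¹ * (C n x z * N n z)) atTop (𝓝 0) :=
      (hA z hz).inv_tendsto_atTop.zero_mul_isBoundedUnder_le
        (isBoundedUnder_of ⟨_, fun n => hCN n x z⟩)
    refine h1.congr' ?_
    filter_upwards [(hA z hz).eventually_gt_atTop 0] with n hn
    field_simp
  -- the block of the information matrix that stays bounded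
  set Q : Matrix {x // x ∉ A} {x // x ∉ A} ℝ :=
    (J + Matrix.diagonal fun x => if x ∈ A then 0 else L x).submatrix Subtype.val Subtype.val
    with hQ
  have hLnn : ∀ x ∉ A, 0 ≤ L x := fun x hx => by
    obtain ⟨n, hn⟩ := (hL x hx).exists
    exact hn ▸ hN n x
  have hQpos : Q.PosDef := by
    refine (hJ.add_posSemidef (Matrix.PosSemidef.diagonal fun x => ?_)).submatrix
      Subtype.val_injective
    by_cases hx : x ∈ A <;> simp [hx, hLnn]
  have hQu : IsUnit Q.det := (Matrix.isUnit_iff_isUnit_det _).mp hQpos.isUnit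
  set D : Matrix X X ℝ := Matrix.of fun x z =>
    if h : x ∉ A ∧ z ∉ A then Q⁻¹ ⟨x, h.1⟩ ⟨z, h.2⟩ else 0 with hD
  have hblock : ∀ x, Tendsto (fun n => fun z : {x // x ∉ A} => C n x z) atTop
      (𝓝 (Matrix.vecMul (fun z : {x // x ∉ A} => (1 : Matrix X X ℝ) x z) Q⁻¹)) := by
    intro x
    have hrhs : Tendsto (fun n => fun z : {x // x ∉ A} =>
        (1 : Matrix X X ℝ) x z - ∑ y : {x // x ∈ A}, C n x y * J y z) atTop
        (𝓝 fun z : {x // x ∉ A} => (1 : Matrix X X ℝ) x z) := by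
      refine tendsto_pi_nhds.2 fun z => ?_
      have : Tendsto (fun n => ∑ y : {x // x ∈ A}, C n x y * J y z) atTop
          (𝓝 (∑ y : {x // x ∈ A}, 0 * J y z)) :=
        tendsto_finsetSum _ fun y _ => (hzero x y y.2).mul_const _
      simpa using this.const_sub ((1 : Matrix X X ℝ) x z)
    have hcont : Continuous fun r : {x // x ∉ A} → ℝ => Matrix.vecMul r Q⁻¹ := by fun_prop
    refine ((hcont.tendsto _).comp hrhs).congr' ?_
    have hev : ∀ᶠ n in atTop, ∀ z : {x // x ∉ A}, N n z = L z :=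
      eventually_all.2 fun z => hL z z.2
    filter_upwards [hev] with n hn
    have : Matrix.vecMul (fun z : {x // x ∉ A} => C n x z) Q = fun z : {x // x ∉ A} =>
        (1 : Matrix X X ℝ) x z - ∑ y : {x // x ∈ A}, C n x y * J y z := by
      ext z
      have h1 := hcol n x z
      rw [Matrix.mul_apply, ← Fintype.sum_subtype_add_sum_subtype (fun y => y ∈ A), hn z] at h1
      have h2 : Matrix.vecMul (fun z : {x // x ∉ A} => C n x z) Q z =
          ∑ y : {x // x ∉ A}, C n x y * J y z + C n x z * L z := by
        simp only [Matrix.vecMul, dotProduct, hQ, Matrix.submatrix_apply, Matrix.add_apply,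
          mul_add, Finset.sum_add_distrib]
        congr 1
        rw [Finset.sum_eq_single z]
        · simp [z.2]
        · intro y _ hy
          rw [Matrix.diagonal_apply_ne _ (fun h => hy (Subtype.ext h)), mul_zero]
        · simp
      rw [h2]
      linarith
    simp only [Function.comp, ← this]
    rw [Matrix.vecMul_vecMul, Matrix.mul_nonsing_inv _ hQu, Matrix.vecMul_one]
  refine ⟨D, fun x z => ?_, fun x hx z => ?_, fun x z hz => ?_, fun x hx => ?_⟩
  · by_cases hz : z ∈ A
    · simpa [hD, hz] using hzero x z hz
    · have h1 := tendsto_pi_nhds.1 (hblock x) ⟨z, hz⟩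
      convert h1 using 2
      by_cases hx : x ∈ A
      · have : (fun z : {x // x ∉ A} => (1 : Matrix X X ℝ) x z) = 0 := by
          ext y
          exact Matrix.one_apply_ne fun h => y.2 (h ▸ hx)
        rw [this, Matrix.zero_vecMul]
        simp [hD, hx]
      · have : (fun z : {x // x ∉ A} => (1 : Matrix X X ℝ) x z) = Pi.single ⟨x, hx⟩ 1 := by
          ext y
          simp only [Matrix.one_apply, Pi.single_apply, Subtype.ext_iff, eq_comm]
        rw [this, Matrix.single_one_vecMul]
        simp [hD, hx, hz]
  · simp [hD, hx]
  · simp [hD, hz]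
  · simpa [hD, hx] using hQpos.inv.diag_pos

theorem tendsto_count_atTop {p : ℕ → Prop} [DecidablePred p] (hp : {i | p i}.Infinite) :
    Tendsto (Nat.count p) atTop atTop :=
  tendsto_atTop_atTop_of_monotone (Nat.count_monotone p) fun b =>
    ⟨Nat.nth p b, (Nat.count_nth_of_infinite hp b).ge⟩

open Classical in
/-- If the averages of the errors vanish in the limit at every design that is observed infinitely
often, the noisy posterior converges, and its limit resolves the function exactly at these designs.
-/
theorem exists_tendsto_posterior {X : Type*} [Fintype X] {k : Matrix X X ℝ} (hk : k.PosDef)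
    (m f : X → ℝ) {v : ℝ≥0} (hv : 0 < v) (d : ℕ → X) {y e : ℕ → ℝ}
    (hy : ∀ i, y i = f (d i) + e i)
    (hslln : ∀ x, {i | d i = x}.Infinite → Tendsto (fun n =>
      (∑ i ∈ Finset.range n, if d i = x then e i else 0) / Nat.count (fun i => d i = x) n)
      atTop (𝓝 0)) :
    ∃ b : Belief X, (∀ x, Tendsto (fun n => (posterior m k v d y n).mean x) atTop (𝓝 (b.mean x))) ∧
      (∀ x x', Tendsto (fun n => (posterior m k v d y n).cov x x') atTop (𝓝 (b.cov x x'))) ∧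
      Resolves b f {x | {i | d i = x}.Infinite} := by
  set A : Set X := {x | {i | d i = x}.Infinite} with hA
  have hv' : (0 : ℝ) < v := by positivity
  have hsum : ∀ n (g : ℕ → ℝ), ∑ i : trainingSet v d n, g i = ∑ i ∈ Finset.range n, g i := by
    intro n g
    rw [Finset.sum_coe_sort, trainingSet, Finset.filter_true_of_mem fun _ _ => Or.inl hv]
  have hcount : ∀ n x, (∑ i ∈ Finset.range n, if d i = x then (1 : ℝ) else 0) =
      Nat.count (fun i => d i = x) n := by
    intro n x
    rw [Nat.count_eq_card_filter_range, Finset.sum_boole]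
  have hform : ∀ n, Matrix.of (posterior m k v d y n).cov * (k⁻¹ + Matrix.diagonal fun x =>
        (v : ℝ)⁻¹ * Nat.count (fun i => d i = x) n) = 1 ∧
      (∀ x, (posterior m k v d y n).mean x = f x + ((Matrix.of (posterior m k v d y n).cov).mulVec
        ((v : ℝ)⁻¹ • (fun z => ∑ i ∈ Finset.range n, if d i = z then e i else 0) -
          k⁻¹.mulVec (f - m))) x) ∧
      ∀ x, (posterior m k v d y n).cov x x ≤ k x x := by
    intro n
    have hp : (gpPosterior m k v (fun i : trainingSet v d n => d i) fun i => f (d i) + e i) =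
        posterior m k v d y n := by simp only [posterior, hy]
    have h := gpPosterior_information_form hk m f hv
      (fun i : trainingSet v d n => d i) (fun i : trainingSet v d n => e i)
    simp only [hp] at h
    obtain ⟨h1, h2, h3⟩ := h
    have hs1 : (fun x => ∑ i : trainingSet v d n, if d i = x then (1 : ℝ) else 0) =
        fun x => (Nat.count (fun i => d i = x) n : ℝ) := by
      ext x
      exact (hsum n fun i => if d i = x then 1 else 0).trans (hcount n x)
    have hs2 : (fun z => ∑ i : trainingSet v d n, if d i = z then e i else 0) =
        fun z => ∑ i ∈ Finset.range n, if d i = z then e i else 0 := by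
      ext z
      exact hsum n fun i => if d i = z then e i else 0
    rw [hs1, ← Matrix.diagonal_smul] at h1
    rw [hs2] at h2
    exact ⟨h1, h2, h3⟩
  have hAtop : ∀ x ∈ A, Tendsto (fun n => (Nat.count (fun i => d i = x) n : ℝ)) atTop atTop :=
    fun x hx => tendsto_natCast_atTop_atTop.comp (tendsto_count_atTop hx)
  -- a design observed finitely often is not observed any more after some time
  have hlast : ∀ x ∉ A, ∃ M, ∀ n ≥ M, d n ≠ x := fun x hx => by
    obtain ⟨M, hM⟩ := (Set.not_infinite.1 hx).bddAbove
    exact ⟨M + 1, fun n hn h => by have := hM h; omega⟩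
  have hfrozen : ∀ x ∉ A, ∀ g : ℕ → ℝ, ∃ l, ∀ᶠ n in atTop,
      (∑ i ∈ Finset.range n, if d i = x then g i else 0) = l := by
    intro x hx g
    obtain ⟨M, hM⟩ := hlast x hx
    refine ⟨∑ i ∈ Finset.range M, if d i = x then g i else 0, ?_⟩
    filter_upwards [eventually_ge_atTop M] with n hn
    refine (Finset.sum_subset (Finset.range_subset_range.2 hn) fun i _ hi => ?_).symm
    rw [if_neg (hM i (not_lt.1 fun h => hi (Finset.mem_range.2 h)))]
  choose! lN hlN using fun x hx => hfrozen x hx fun _ => 1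
  choose! lE hlE using fun x hx => hfrozen x hx e
  obtain ⟨⟨R, hR⟩, D, hD, hDA, hDA', hDpos⟩ := exists_tendsto_inv_add_diagonal hk.inv
    (N := fun n x => (v : ℝ)⁻¹ * Nat.count (fun i => d i = x) n) (fun n x => by positivity)
    (C := fun n => Matrix.of (posterior m k v d y n).cov) (fun n => (hform n).1)
    (R := fun x => k x x) (fun n => (hform n).2.2) (A := A)
    (fun x hx => (hAtop x hx).const_mul_atTop (by positivity)) (L := fun x => (v : ℝ)⁻¹ * lN x)
    (fun x hx => (hlN x hx).mono fun n hn => by rw [← hn, hcount])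
  -- the contribution of the errors to the posterior mean
  have hnoise : ∀ x z, Tendsto (fun n => (posterior m k v d y n).cov x z *
      ((v : ℝ)⁻¹ * ∑ i ∈ Finset.range n, if d i = z then e i else 0)) atTop
      (𝓝 (D x z * ((v : ℝ)⁻¹ * lE z))) := by
    intro x z
    by_cases hz : z ∈ A
    · rw [hDA' x z hz, zero_mul]
      refine ((hslln z hz).zero_mul_isBoundedUnder_le
        (isBoundedUnder_of ⟨_, fun n => hR n x z⟩)).congr' ?_
      filter_upwards [(hAtop z hz).eventually_gt_atTop 0] with n hn
      simp only [Matrix.of_apply]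
      field_simp
    · exact (hD x z).mul (((tendsto_const_nhds.congr'
        ((hlE z hz).mono fun n hn => hn.symm)).const_mul _))
  refine ⟨⟨fun x => f x + ∑ z, (D x z * ((v : ℝ)⁻¹ * lE z) - D x z * (k⁻¹.mulVec (f - m)) z),
    fun x z => D x z⟩, fun x => ?_, hD, ?_, hDA, hDpos⟩
  · refine Tendsto.congr (fun n => ((hform n).2.1 x).symm) (tendsto_const_nhds.add ?_)
    simp only [Matrix.mulVec, dotProduct, Pi.sub_apply, Pi.smul_apply, smul_eq_mul, mul_sub]
    exact tendsto_finsetSum _ fun z _ => (hnoise x z).sub ((hD x z).mul_const _)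
  · intro x hx
    simp [hDA x hx]

/-! ### A strong law of large numbers along predictable times -/

section Reindexing

variable {p : ℕ → Prop} [DecidablePred p]

/-- A sum over the times before `n` at which `p` holds, reindexed by the occurrences of `p`. -/
theorem sum_range_ite_eq_sum_range_count (g : ℕ → ℕ → ℝ) (n : ℕ) :
    (∑ i ∈ Finset.range n, if p i then g (Nat.count p i) i else 0) =
      ∑ j ∈ Finset.range (Nat.count p n), g j (Nat.nth p j) := by
  induction n with
  | zero => simp
  | succ n ih =>
    rw [Finset.sum_range_succ, ih, Nat.count_succ]
    split_ifs with h
    · rw [Finset.sum_range_succ, Nat.nth_count h]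
    · simp

/-- Kronecker's lemma for the weights `1 / (j + 1)`. -/
theorem tendsto_average_of_tendsto_sum_div {a : ℕ → ℝ} {s : ℝ}
    (h : Tendsto (fun n => ∑ j ∈ Finset.range n, a j / (j + 1)) atTop (𝓝 s)) :
    Tendsto (fun n : ℕ => (∑ j ∈ Finset.range n, a j) / n) atTop (𝓝 0) := by
  set S : ℕ → ℝ := fun n => ∑ j ∈ Finset.range n, a j / (j + 1) with hS
  -- summation by parts
  have habel : ∀ n : ℕ, ∑ j ∈ Finset.range n, a j = n * S n - ∑ j ∈ Finset.range n, S j := by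
    intro n
    induction n with
    | zero => simp
    | succ n ih =>
      rw [Finset.sum_range_succ, ih, Finset.sum_range_succ _ n]
      have : S (n + 1) = S n + a n / (n + 1) := Finset.sum_range_succ _ _
      rw [this]
      push_cast
      field_simp
      ring
  have h2 := h.sub h.cesaro
  rw [sub_self] at h2
  refine h2.congr' ?_
  filter_upwards [eventually_gt_atTop 0] with n hn
  have : (n : ℝ) ≠ 0 := by positivity
  rw [habel]
  field_simp

theorem sum_range_ite_div_count_sq_le (n : ℕ) :
    (∑ i ∈ Finset.range n, (if p i then ((Nat.count p i : ℝ) + 1)⁻¹ else 0) ^ 2) ≤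
      ∑' j : ℕ, (((j : ℝ) + 1)⁻¹) ^ 2 := by
  have hs : Summable fun j : ℕ => (((j : ℝ) + 1)⁻¹) ^ 2 := by
    have := (summable_nat_add_iff 1).2 (Real.summable_nat_pow_inv.2 one_lt_two)
    refine this.congr fun j => ?_
    push_cast
    rw [inv_pow]
  have : ∀ i, (if p i then ((Nat.count p i : ℝ) + 1)⁻¹ else 0) ^ 2 =
      if p i then (((Nat.count p i : ℝ) + 1)⁻¹) ^ 2 else 0 := fun i => by
    split_ifs <;> simp
  simp only [this]
  rw [sum_range_ite_eq_sum_range_count (fun j _ => (((j : ℝ) + 1)⁻¹) ^ 2)]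
  exact hs.sum_le_tsum _ fun _ _ => by positivity

end Reindexing

section Martingale

variable {Ω : Type*} {mΩ : MeasurableSpace Ω} {P : Measure Ω} [IsProbabilityMeasure P]

/-- A martingale transform `∑ hᵢ εᵢ` of centred square-integrable noise, with predictable bounded
coefficients of bounded square sum, converges almost surely. -/
theorem ae_exists_tendsto_sum_mul {ℱ : Filtration ℕ mΩ} {ε h : ℕ → Ω → ℝ} {w R : ℝ}
    (hε_meas : ∀ n, Measurable[ℱ (n + 1)] (ε n)) (hε_L2 : ∀ n, MemLp (ε n) 2 P)
    (hε_mean : ∀ n, P[ε n] = 0) (hε_sq : ∀ n, ∫ ω, ε n ω ^ 2 ∂P = w)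
    (hε_indep : ∀ n, Indep (MeasurableSpace.comap (ε n) inferInstance) (ℱ n) P)
    (hh_meas : ∀ n, Measurable[ℱ n] (h n)) (hh_bdd : ∀ n ω, |h n ω| ≤ 1)
    (hh_sq : ∀ n ω, ∑ i ∈ Finset.range n, h i ω ^ 2 ≤ R) :
    ∀ᵐ ω ∂P, ∃ s, Tendsto (fun n => ∑ i ∈ Finset.range n, h i ω * ε i ω) atTop (𝓝 s) := by
  set M : ℕ → Ω → ℝ := fun n ω => ∑ i ∈ Finset.range n, h i ω * ε i ω with hM
  have hh_meas' : ∀ n, Measurable (h n) := fun n => (hh_meas n).mono (ℱ.le n) le_rfl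
  have hε_meas' : ∀ n, Measurable (ε n) := fun n => (hε_meas n).mono (ℱ.le _) le_rfl
  have hL2 : ∀ n, MemLp (fun ω => h n ω * ε n ω) 2 P := fun n => by
    refine (hε_L2 n).mono ((hh_meas' n).mul (hε_meas' n)).aestronglyMeasurable
      (ae_of_all _ fun ω => ?_)
    rw [norm_mul]
    exact mul_le_of_le_one_left (norm_nonneg _) (hh_bdd n ω)
  have hM_L2 : ∀ n, MemLp (M n) 2 P := fun n => memLp_finsetSum _ fun i _ => hL2 i
  have hM_succ : ∀ n, M (n + 1) = M n + fun ω => h n ω * ε n ω := fun n => by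
    ext ω
    exact Finset.sum_range_succ _ _
  have hM_adapted : ∀ n, Measurable[ℱ n] (M n) := fun n =>
    Finset.measurable_sum _ fun i hi =>
      ((hh_meas i).mono (ℱ.mono (Finset.mem_range.1 hi).le) le_rfl).mul
        ((hε_meas i).mono (ℱ.mono (Finset.mem_range.1 hi)) le_rfl)
  have hmart : Martingale M ℱ P := by
    refine martingale_of_condExp_sub_eq_zero_nat (fun n => (hM_adapted n).stronglyMeasurable)
      (fun n => (hM_L2 n).integrable one_le_two) fun n => ?_
    have h1 : M (n + 1) - M n = h n * ε n := by
      rw [hM_succ]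
      exact add_sub_cancel_left _ _
    rw [h1]
    have h2 := condExp_mul_of_stronglyMeasurable_left (μ := P) (hh_meas n).stronglyMeasurable
      ((hL2 n).integrable one_le_two) ((hε_L2 n).integrable one_le_two)
    have h3 : P[ε n | ℱ n] =ᵐ[P] fun _ => P[ε n] :=
      condExp_indep_eq (hε_meas' n).comap_le (ℱ.le n)
        (comap_measurable (ε n)).stronglyMeasurable (hε_indep n)
    filter_upwards [h2, h3] with ω h2 h3
    rw [h2, Pi.mul_apply, h3, hε_mean, mul_zero, Pi.zero_apply]
  -- the increments are orthogonal
  have hsq : ∀ n, ∫ ω, M n ω ^ 2 ∂P = w * ∫ ω, ∑ i ∈ Finset.range n, h i ω ^ 2 ∂P := by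
    intro n
    have hh_int : ∀ i, Integrable (fun ω => h i ω ^ 2) P := fun i =>
      Integrable.of_bound ((hh_meas' i).pow_const 2).aestronglyMeasurable 1
        (ae_of_all _ fun ω => by
          rw [norm_pow, Real.norm_eq_abs]
          exact pow_le_one₀ (abs_nonneg _) (hh_bdd i ω))
    induction n with
    | zero => simp [hM]
    | succ n ih =>
      have hind : ∀ {g : Ω → ℝ}, Measurable[ℱ n] g → IndepFun g (ε n) P := fun {g} hg =>
        (indep_of_indep_of_le_right (hε_indep n) hg.comap_le).symm
      have hcross : ∫ ω, (M n ω * h n ω) * ε n ω ∂P = 0 := by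
        refine ((hind ((hM_adapted n).mul (hh_meas n))).integral_fun_mul_eq_mul_integral
          ((hM_L2 n).aestronglyMeasurable.mul (hh_meas' n).aestronglyMeasurable)
          (hε_meas' n).aestronglyMeasurable).trans ?_
        rw [hε_mean, mul_zero]
      have hincr : ∫ ω, h n ω ^ 2 * ε n ω ^ 2 ∂P = (∫ ω, h n ω ^ 2 ∂P) * w := by
        rw [← hε_sq n]
        exact ((hind (hh_meas n)).comp (measurable_id.pow_const 2)
          (measurable_id.pow_const 2)).integral_fun_mul_eq_mul_integral
          ((hh_meas' n).pow_const 2).aestronglyMeasurable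
          ((hε_meas' n).pow_const 2).aestronglyMeasurable
      have hcross_int : Integrable (fun ω => (M n ω * h n ω) * ε n ω) P := by
        refine ((hM_L2 n).integrable_mul (hL2 n)).congr (ae_of_all _ fun ω => ?_)
        simp only [Pi.mul_apply]
        ring
      have hincr_int : Integrable (fun ω => h n ω ^ 2 * ε n ω ^ 2) P :=
        (hL2 n).integrable_sq.congr (ae_of_all _ fun ω => mul_pow _ _ _)
      have hsum_int : Integrable (fun ω => M n ω ^ 2 + 2 * ((M n ω * h n ω) * ε n ω)) P :=
        (hM_L2 n).integrable_sq.add (hcross_int.const_mul 2)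
      calc ∫ ω, M (n + 1) ω ^ 2 ∂P
          = ∫ ω, (M n ω ^ 2 + 2 * ((M n ω * h n ω) * ε n ω)) + h n ω ^ 2 * ε n ω ^ 2 ∂P := by
            refine integral_congr_ae (ae_of_all _ fun ω => ?_)
            simp only [hM_succ, Pi.add_apply]
            ring
        _ = w * ∫ ω, ∑ i ∈ Finset.range n, h i ω ^ 2 ∂P + (∫ ω, h n ω ^ 2 ∂P) * w := by
            rw [integral_add hsum_int hincr_int,
              integral_add (hM_L2 n).integrable_sq (hcross_int.const_mul 2),
              integral_const_mul, hcross, hincr, ih]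
            ring
        _ = w * ∫ ω, ∑ i ∈ Finset.range (n + 1), h i ω ^ 2 ∂P := by
            simp only [Finset.sum_range_succ]
            rw [integral_add (integrable_finsetSum _ fun i _ => hh_int i) (hh_int n)]
            ring
  have hw : 0 ≤ w := by
    rw [← hε_sq 0]
    exact integral_nonneg fun ω => sq_nonneg _
  have hbdd : ∀ n, ∫ ω, M n ω ^ 2 ∂P ≤ w * R := fun n => by
    rw [hsq]
    refine mul_le_mul_of_nonneg_left ?_ hw
    calc ∫ ω, ∑ i ∈ Finset.range n, h i ω ^ 2 ∂P ≤ ∫ _, R ∂P :=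
          integral_mono_of_nonneg (ae_of_all _ fun ω => Finset.sum_nonneg fun i _ => sq_nonneg _)
            (integrable_const R) (ae_of_all _ (hh_sq n))
      _ = R := by simp
  refine hmart.submartingale.exists_ae_tendsto_of_bdd (R := (1 + w * R).toNNReal) fun n => ?_
  rw [eLpNorm_one_eq_lintegral_enorm, ← ofReal_integral_norm_eq_lintegral_enorm
    ((hM_L2 n).integrable one_le_two)]
  refine ENNReal.ofReal_le_ofReal ?_
  calc ∫ ω, ‖M n ω‖ ∂P ≤ ∫ ω, 1 + M n ω ^ 2 ∂P := by
        refine integral_mono ((hM_L2 n).integrable one_le_two).norm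
          ((integrable_const 1).add (hM_L2 n).integrable_sq) fun ω => ?_
        simp only [Real.norm_eq_abs]
        nlinarith [sq_abs (M n ω), sq_nonneg (|M n ω| - 1), abs_nonneg (M n ω)]
    _ = 1 + ∫ ω, M n ω ^ 2 ∂P := by
        rw [integral_add (integrable_const 1) (hM_L2 n).integrable_sq]
        simp
    _ ≤ 1 + w * R := by linarith [hbdd n]

/-- Strong law of large numbers for noise sampled at the predictable random times `{n | p n ω}`. -/
theorem ae_tendsto_average_of_predictable {ℱ : Filtration ℕ mΩ} {ε : ℕ → Ω → ℝ} {w : ℝ}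
    (hε_meas : ∀ n, Measurable[ℱ (n + 1)] (ε n)) (hε_L2 : ∀ n, MemLp (ε n) 2 P)
    (hε_mean : ∀ n, P[ε n] = 0) (hε_sq : ∀ n, ∫ ω, ε n ω ^ 2 ∂P = w)
    (hε_indep : ∀ n, Indep (MeasurableSpace.comap (ε n) inferInstance) (ℱ n) P)
    {p : ℕ → Ω → Prop} [∀ ω, DecidablePred fun i => p i ω]
    (hp : ∀ n, MeasurableSet[ℱ n] {ω | p n ω}) :
    ∀ᵐ ω ∂P, {i | p i ω}.Infinite →
      Tendsto (fun n => (∑ i ∈ Finset.range n, if p i ω then ε i ω else 0) /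
        Nat.count (fun i => p i ω) n) atTop (𝓝 0) := by
  set h : ℕ → Ω → ℝ := fun i ω =>
    if p i ω then ((Nat.count (fun i => p i ω) i : ℝ) + 1)⁻¹ else 0 with hh
  have hcount : ∀ n, Measurable[ℱ n] fun ω => (Nat.count (fun i => p i ω) n : ℝ) := by
    intro n
    simp only [Nat.count_eq_card_filter_range, ← Finset.sum_boole]
    exact Finset.measurable_sum _ fun i hi => Measurable.ite
      (ℱ.mono (Finset.mem_range.1 hi).le _ (hp i)) measurable_const measurable_const
  have hconv := ae_exists_tendsto_sum_mul (h := h) (R := ∑' j : ℕ, (((j : ℝ) + 1)⁻¹) ^ 2)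
    hε_meas hε_L2 hε_mean hε_sq hε_indep
    (fun n => Measurable.ite (hp n) ((hcount n).add_const 1).inv measurable_const)
    (fun n ω => by
      simp only [hh]
      split_ifs
      · rw [abs_of_nonneg (by positivity)]
        exact inv_le_one_of_one_le₀ (by simp)
      · simp)
    (fun n ω => sum_range_ite_div_count_sq_le n)
  filter_upwards [hconv] with ω ⟨s, hs⟩ hinf
  have hsum : Tendsto (fun n => ∑ j ∈ Finset.range n, ε (Nat.nth (fun i => p i ω) j) ω / (j + 1))
      atTop (𝓝 s) := by
    have h1 := hs.comp (Nat.nth_strictMono hinf).tendsto_atTop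
    refine h1.congr fun n => ?_
    have h2 := sum_range_ite_eq_sum_range_count (p := fun i => p i ω)
      (fun j i => ε i ω / (j + 1)) (Nat.nth (fun i => p i ω) n)
    rw [Nat.count_nth_of_infinite hinf] at h2
    rw [← h2]
    refine Finset.sum_congr rfl fun i _ => ?_
    simp only [hh]
    split_ifs
    · rw [inv_mul_eq_div]
    · rw [zero_mul]
  refine ((tendsto_average_of_tendsto_sum_div hsum).comp (tendsto_count_atTop hinf)).congr
    fun n => ?_
  rw [sum_range_ite_eq_sum_range_count (p := fun i => p i ω) (fun _ i => ε i ω)]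
  rfl

end Martingale

/-! ### The filtration of the sampling process -/

section Filtration

variable {Ω : Type*} {mΩ : MeasurableSpace Ω} {P : Measure Ω} [IsProbabilityMeasure P]

theorem indepFun_prodMk_of_indepFun_prodMk {α β γ : Type*} [MeasurableSpace α] [MeasurableSpace β]
    [MeasurableSpace γ] {f : Ω → α} {g : Ω → β} {h : Ω → γ} (hf : Measurable f) (hg : Measurable g)
    (hh : Measurable h) (hfg : IndepFun f g P) (hfgh : IndepFun (fun ω => (f ω, g ω)) h P) :
    IndepFun f (fun ω => (g ω, h ω)) P := by
  have hgh : IndepFun g h P := hfgh.comp measurable_snd measurable_id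
  rw [indepFun_iff_map_prod_eq_prod_map_map hf.aemeasurable (hg.prodMk hh).aemeasurable,
    (indepFun_iff_map_prod_eq_prod_map_map hg.aemeasurable hh.aemeasurable).1 hgh,
    ← Measure.prodAssoc_prod,
    ← (indepFun_iff_map_prod_eq_prod_map_map hf.aemeasurable hg.aemeasurable).1 hfg,
    ← (indepFun_iff_map_prod_eq_prod_map_map (hf.prodMk hg).aemeasurable hh.aemeasurable).1 hfgh,
    Measure.map_map MeasurableEquiv.prodAssoc.measurable ((hf.prodMk hg).prodMk hh)]
  rfl

variable {β S : Type*} [MeasurableSpace β] [MeasurableSpace S]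

/-- Everything that determines the first `n` observations: the noise before time `n`, the unknown
functions `g`, and the random seed `U`. -/
def history (ε : Ω → ℕ → ℝ) (g : Ω → β) (U : Ω → S) (n : ℕ) (ω : Ω) :
    ((Finset.range n → ℝ) × β) × S :=
  ((fun i => ε ω i, g ω), U ω)

theorem measurable_history_iff {m : MeasurableSpace Ω} {ε : Ω → ℕ → ℝ} {g : Ω → β} {U : Ω → S}
    {n : ℕ} : Measurable (history ε g U n) ↔
      (∀ i < n, Measurable fun ω => ε ω i) ∧ Measurable g ∧ Measurable U := by
  refine ⟨fun h => ⟨fun i hi => ?_, h.fst.snd, h.snd⟩, fun h => ?_⟩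
  · exact (measurable_pi_apply (⟨i, Finset.mem_range.2 hi⟩ : Finset.range n)).comp h.fst.fst
  · have hε : Measurable fun ω (i : Finset.range n) => ε ω i :=
      measurable_pi_lambda _ fun i => h.1 i (Finset.mem_range.1 i.2)
    exact (hε.prodMk h.2.1).prodMk h.2.2

/-- The filtration generated by `history`. -/
def historyFiltration {ε : Ω → ℕ → ℝ} {g : Ω → β} {U : Ω → S} (hε : Measurable ε)
    (hg : Measurable g) (hU : Measurable U) : Filtration ℕ mΩ where
  seq n := MeasurableSpace.comap (history ε g U n) inferInstance
  mono' n n' hn := by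
    have h := measurable_history_iff.1 (comap_measurable (history ε g U n'))
    exact measurable_iff_comap_le.1 (measurable_history_iff.2
      ⟨fun i hi => h.1 i (hi.trans_le hn), h.2⟩)
  le' n := measurable_iff_comap_le.1
    (measurable_history_iff.2 ⟨fun i _ => (measurable_pi_apply i).comp hε, hg, hU⟩)

theorem measurable_historyFiltration {ε : Ω → ℕ → ℝ} {g : Ω → β} {U : Ω → S} (hε : Measurable ε)
    (hg : Measurable g) (hU : Measurable U) (n : ℕ) :
    (∀ i < n, Measurable[historyFiltration hε hg hU n] fun ω => ε ω i) ∧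
      Measurable[historyFiltration hε hg hU n] g ∧ Measurable[historyFiltration hε hg hU n] U :=
  measurable_history_iff.1 (comap_measurable (history ε g U n))

/-- The noise of an observation is independent of everything that the sampling rule has seen. -/
theorem indep_noise_historyFiltration {ε : Ω → ℕ → ℝ} {g : Ω → β} {U : Ω → S} (hε : Measurable ε)
    (hg : Measurable g) (hU : Measurable U) (hεi : iIndepFun (fun n ω => ε ω n) P)
    (hgε : IndepFun g ε P) (hgεU : IndepFun (fun ω => (g ω, ε ω)) U P) (n : ℕ) :
    Indep (MeasurableSpace.comap (fun ω => ε ω n) inferInstance)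
      (historyFiltration hε hg hU n) P := by
  have hεm : ∀ i, Measurable fun ω => ε ω i := fun i => (measurable_pi_apply i).comp hε
  have hpast : Measurable fun ω (i : Finset.range n) => ε ω i :=
    measurable_pi_lambda _ fun i => hεm i
  have h1 : IndepFun (fun ω => ε ω n) (fun ω (i : Finset.range n) => ε ω i) P := by
    have hev : Measurable fun u : ({n} : Finset ℕ) → ℝ => u ⟨n, Finset.mem_singleton_self n⟩ :=
      measurable_pi_apply _
    exact (hεi.indepFun_finset {n} (Finset.range n) (by simp) hεm).comp hev measurable_id
  have hsel : Measurable fun u : ℕ → ℝ => (u n, fun i : Finset.range n => u i) := by fun_prop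
  have h2 : IndepFun (fun ω => ε ω n) (fun ω => (fun i : Finset.range n => ε ω i, g ω)) P :=
    indepFun_prodMk_of_indepFun_prodMk (hεm n) hpast hg h1 (hgε.symm.comp hsel measurable_id)
  have hsel' : Measurable fun u : β × (ℕ → ℝ) =>
      (u.2 n, (fun i : Finset.range n => u.2 i, u.1)) := by fun_prop
  exact indepFun_prodMk_of_indepFun_prodMk (hεm n) (hpast.prodMk hg) hU h2
    (hgεU.comp hsel' measurable_id)

theorem measurable_eval_design {X : Type*} [Countable X] [MeasurableSpace X]
    [MeasurableSingletonClass X] {m : MeasurableSpace Ω} {g : Ω → X → ℝ} {x : Ω → X}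
    (hg : Measurable g) (hx : Measurable x) : Measurable fun ω => g ω (x ω) := by
  have h : Measurable fun q : (X → ℝ) × X => q.1 q.2 :=
    measurable_from_prod_countable_left fun z => measurable_pi_apply z
  exact h.comp (hg.prodMk hx)

/-- The sampling rule is nonanticipating: the `n`-th design is known before the `n`-th noise. -/
theorem measurable_design {X : Type*} [Countable X] [MeasurableSpace X]
    [MeasurableSingletonClass X] {K : ℕ} {f : Ω → X → ℝ} {c : Ω → Fin K → X → ℝ} {ε : Ω → ℕ → ℝ}
    {U : Ω → S} (hε : Measurable ε) (hfc : Measurable fun ω => (f ω, c ω)) (hU : Measurable U)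
    {π : (n : ℕ) → S × (Fin n → X × ℝ × (Fin K → ℝ)) → X} (hπ : ∀ n, Measurable (π n))
    {d : Ω → ℕ → X} (hd : ∀ ω n, d ω n = π n (U ω, fun i : Fin n =>
      (d ω i, f ω (d ω i) + ε ω i, fun k => c ω k (d ω i)))) (n : ℕ) :
    Measurable[historyFiltration hε hfc hU n] fun ω => d ω n := by
  induction n using Nat.strong_induction_on with
  | _ n ih =>
    obtain ⟨hεn, hfcn, hUn⟩ := measurable_historyFiltration hε hfc hU n
    let _ : MeasurableSpace Ω := historyFiltration hε hfc hU n
    have hdi : ∀ i : Fin n, Measurable fun ω => d ω i := fun i =>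
      (ih i i.2).mono ((historyFiltration hε hfc hU).mono i.2.le) le_rfl
    simp only [hd _ n]
    refine (hπ n).comp (hUn.prodMk (measurable_pi_lambda _ fun i => (hdi i).prodMk
      (((measurable_eval_design hfcn.fst (hdi i)).add (hεn i i.2)).prodMk
        (measurable_pi_lambda _ fun k => measurable_eval_design
          ((measurable_pi_apply k).comp hfcn.snd) (hdi i)))))

end Filtration

/-! ### Convergence of the posterior of the objective -/

/-- The posterior of the objective converges almost surely, and its limit resolves the objective at
some nonempty set of sampled designs. -/
theorem ae_exists_tendsto_objective_posterior
    {X : Type*} [Fintype X] [MeasurableSpace X] [MeasurableSingletonClass X] {K : ℕ}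
    {Ω : Type*} [MeasurableSpace Ω] {P : Measure Ω} [IsProbabilityMeasure P]
    (m : X → ℝ) {k : Matrix X X ℝ} (hk : k.PosDef) (v : ℝ≥0)
    {f : Ω → X → ℝ} {c : Ω → Fin K → X → ℝ} (hfc : Measurable fun ω => (f ω, c ω))
    {ε : Ω → ℕ → ℝ} (hε : Measurable ε) (hε_law : ∀ n, HasLaw (fun ω => ε ω n) (gaussianReal 0 v) P)
    {S : Type*} [MeasurableSpace S] {U : Ω → S} (hU : Measurable U)
    (hε_indep : iIndepFun (fun n ω => ε ω n) P)
    (hfcε_indep : IndepFun (fun ω => (f ω, c ω)) ε P)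
    (hU_indep : IndepFun (fun ω => ((f ω, c ω), ε ω)) U P)
    {π : (n : ℕ) → S × (Fin n → X × ℝ × (Fin K → ℝ)) → X} (hπ : ∀ n, Measurable (π n))
    {d : Ω → ℕ → X} {y : Ω → ℕ → ℝ}
    (hy : ∀ ω n, y ω n = f ω (d ω n) + ε ω n)
    (hd : ∀ ω n, d ω n =
      π n (U ω, fun i : Fin n => (d ω i, y ω i, fun k => c ω k (d ω i)))) :
    ∀ᵐ ω ∂P, ∃ (b : Belief X) (A : Set X),
      (∀ x, Tendsto (fun n => (posterior m k v (d ω) (y ω) n).mean x) atTop (𝓝 (b.mean x))) ∧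
      (∀ x x', Tendsto (fun n => (posterior m k v (d ω) (y ω) n).cov x x') atTop
        (𝓝 (b.cov x x'))) ∧
      Resolves b (f ω) A ∧ A.Nonempty ∧ A ⊆ Set.range (d ω) := by
  classical
  rcases eq_zero_or_pos v with rfl | hv
  · have hzero : ∀ᵐ ω ∂P, ∀ n, ε ω n = 0 := by
      refine ae_all_iff.2 fun n => ((hε_law n).ae_iff (p := fun x => x = 0)
        (measurableSet_setOfPred.1 (measurableSet_singleton 0))).2 ?_
      rw [gaussianReal_zero_var, ae_dirac_eq]
      rfl
    filter_upwards [hzero] with ω hω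
    obtain ⟨b, hb, hres⟩ := exists_resolves_posterior_zero hk m (f ω) (d ω) (y := y ω)
      fun i => by rw [hy, hω, add_zero]
    exact ⟨b, Set.range (d ω), fun x => tendsto_const_nhds.congr' (hb.mono fun n hn =>
        congrArg (fun b => b.mean x) hn.symm),
      fun x x' => tendsto_const_nhds.congr' (hb.mono fun n hn =>
        congrArg (fun b => b.cov x x') hn.symm), hres, Set.range_nonempty _, subset_rfl⟩
  · simp only [hy] at hd
    have hL2 : ∀ n, MemLp (fun ω => ε ω n) 2 P := fun n => by
      have h := memLp_id_gaussianReal (μ := 0) (v := v) 2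
      rw [← (hε_law n).map_eq] at h
      exact h.comp_of_map (hε_law n).aemeasurable
    have hmean : ∀ n, ∫ ω, ε ω n ∂P = 0 := fun n => by
      rw [(hε_law n).integral_eq, integral_id_gaussianReal]
    have hsq : ∀ n, ∫ ω, ε ω n ^ 2 ∂P = v := fun n => by
      have h := (hε_law n).variance_eq
      rwa [variance_id_gaussianReal, variance_of_integral_eq_zero (hε_law n).aemeasurable
        (hmean n)] at h
    have hslln : ∀ᵐ ω ∂P, ∀ x, {i | d ω i = x}.Infinite → Tendsto (fun n =>
        (∑ i ∈ Finset.range n, if d ω i = x then ε ω i else 0) / Nat.count (fun i => d ω i = x) n)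
        atTop (𝓝 0) :=
      ae_all_iff.2 fun x => ae_tendsto_average_of_predictable (ε := fun n ω => ε ω n)
        (ℱ := historyFiltration hε hfc hU) (p := fun n ω => d ω n = x)
        (fun n => (measurable_historyFiltration hε hfc hU (n + 1)).1 n n.lt_succ_self)
        hL2 hmean hsq (indep_noise_historyFiltration hε hfc hU hε_indep hfcε_indep hU_indep)
        fun n => measurable_design hε hfc hU hπ hd n (measurableSet_singleton x)
    filter_upwards [hslln] with ω hω
    obtain ⟨b, hbm, hbc, hres⟩ := exists_tendsto_posterior hk m (f ω) hv (d ω) (hy ω) hω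
    refine ⟨b, _, hbm, hbc, hres, ?_, fun x hx => ?_⟩
    · obtain ⟨x, hx⟩ := Finite.exists_infinite_fiber (d ω)
      exact ⟨x, Set.infinite_coe_iff.1 hx⟩
    · obtain ⟨i, hi⟩ := Set.Infinite.nonempty hx
      exact ⟨i, hi⟩

end CKG

end

/-- `X` is the finite design set; the objective `f` and the constraints `c k` are drawn from
independent Gaussian process priors with positive definite kernels. The `n`-th design `d n` is chosen
by an arbitrary (possibly randomised, through the seed `U`) rule `π n` from the designs and
observations made before; maximising the current cKG is one such rule. An observation at `x` returns
`f x` plus `N(0, v)` noise and the exact constraint values. -/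
theorem mainTheorem2
    {X : Type*} [Fintype X] [MeasurableSpace X] [MeasurableSingletonClass X] {K : ℕ}
    {Ω : Type*} [MeasurableSpace Ω] (P : Measure Ω) [IsProbabilityMeasure P]
    (my : X → ℝ) (ky : Matrix X X ℝ) (hky : ky.PosDef)
    (mc : Fin K → X → ℝ) (kc : Fin K → Matrix X X ℝ) (hkc : ∀ k, (kc k).PosDef)
    (v : ℝ≥0)
    (f : Ω → X → ℝ) (hf_meas : Measurable f)
    (hf_gauss : IsGaussianProcess (fun x ω => f ω x) P)
    (hf_mean : ∀ x, ∫ ω, f ω x ∂P = my x)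
    (hf_cov : ∀ x x', covariance (fun ω => f ω x) (fun ω => f ω x') P = ky x x')
    (c : Ω → Fin K → X → ℝ) (hc_meas : Measurable c)
    (hc_gauss : ∀ k, IsGaussianProcess (fun x ω => c ω k x) P)
    (hc_mean : ∀ k x, ∫ ω, c ω k x ∂P = mc k x)
    (hc_cov : ∀ k x x', covariance (fun ω => c ω k x) (fun ω => c ω k x') P = kc k x x')
    (ε : Ω → ℕ → ℝ) (hε_meas : Measurable ε)
    (hε_law : ∀ n, HasLaw (fun ω => ε ω n) (gaussianReal 0 v) P)
    {S : Type*} [MeasurableSpace S] (U : Ω → S) (hU_meas : Measurable U)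
    (hc_indep : iIndepFun (fun k ω => c ω k) P)
    (hε_indep : iIndepFun (fun n ω => ε ω n) P)
    (hfc_indep : IndepFun f c P)
    (hfcε_indep : IndepFun (fun ω => (f ω, c ω)) ε P)
    (hU_indep : IndepFun (fun ω => ((f ω, c ω), ε ω)) U P)
    (π : (n : ℕ) → S × (Fin n → X × ℝ × (Fin K → ℝ)) → X) (hπ : ∀ n, Measurable (π n))
    (d : Ω → ℕ → X) (y : Ω → ℕ → ℝ)
    (hy : ∀ ω n, y ω n = f ω (d ω n) + ε ω n)
    (hd : ∀ ω n, d ω n =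
      π n (U ω, fun i : Fin n => (d ω i, y ω i, fun k => c ω k (d ω i))))
    (bY : Ω → ℕ → CKG.Belief X)
    (hbY : ∀ ω n, bY ω n = CKG.posterior my ky v (d ω) (y ω) n)
    (bC : Ω → ℕ → Fin K → CKG.Belief X)
    (hbC : ∀ ω n k, bC ω n k =
      CKG.posterior (mc k) (kc k) 0 (d ω) (fun i => c ω k (d ω i)) n) :
    ∀ᵐ ω ∂P, ∃ (bYlim : CKG.Belief X) (bClim : Fin K → CKG.Belief X),
      (∀ x, Tendsto (fun n => (bY ω n).mean x) atTop (𝓝 (bYlim.mean x))) ∧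
      (∀ x x', Tendsto (fun n => (bY ω n).cov x x') atTop (𝓝 (bYlim.cov x x'))) ∧
      (∀ k x, Tendsto (fun n => (bC ω n k).mean x) atTop (𝓝 ((bClim k).mean x))) ∧
      (∀ k x x', Tendsto (fun n => (bC ω n k).cov x x') atTop (𝓝 ((bClim k).cov x x'))) ∧
      (∀ x, Tendsto (fun n => CKG.PF (bC ω n) x) atTop (𝓝 (CKG.PF bClim x))) ∧
      ((CKG.feasible (c ω)).Nonempty →
        ∀ xr ∈ CKG.argmaxSet (CKG.utility bYlim bClim),
        (∀ x, CKG.cKG v bYlim bClim xr x = 0) →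
          CKG.argmaxSet (CKG.utility bYlim bClim) =
              CKG.argmaxSet ((CKG.feasible (c ω)).indicator (f ω)) ∧
            ∀ᶠ n in atTop, CKG.argmaxSet (CKG.utility (bY ω n) (bC ω n)) ⊆
              CKG.argmaxSet ((CKG.feasible (c ω)).indicator (f ω))) := by
  filter_upwards [CKG.ae_exists_tendsto_objective_posterior my hky v (hf_meas.prodMk hc_meas)
    hε_meas hε_law hU_meas hε_indep hfcε_indep hU_indep hπ hy hd] with ω ⟨b, A, hbm, hbc, hb, hA, hAd⟩
  choose bc hbc_ev hbc_res using fun k => CKG.exists_resolves_posterior_zero (hkc k) (mc k) (c ω k)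
    (d ω) (y := fun i => c ω k (d ω i)) fun _ => rfl
  have hev : ∀ᶠ n in atTop, bC ω n = bc := by
    filter_upwards [eventually_all.2 hbc_ev] with n hn
    ext1 k
    rw [hbC, hn]
  simp only [← hbY] at hbm hbc
  have hPF : ∀ x, Tendsto (fun n => CKG.PF (bC ω n) x) atTop (𝓝 (CKG.PF bc x)) := fun x =>
    tendsto_const_nhds.congr' (hev.mono fun n hn => congrArg (fun b => CKG.PF b x) hn.symm)
  refine ⟨b, bc, hbm, hbc,
    fun k x => tendsto_const_nhds.congr' (hev.mono fun n hn =>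
      congrArg (fun b => (b k).mean x) hn.symm),
    fun k x x' => tendsto_const_nhds.congr' (hev.mono fun n hn =>
      congrArg (fun b => (b k).cov x x') hn.symm),
    hPF, fun _ xr _ hcKG => ?_⟩
  rw [← CKG.utility_eq_indicator_of_cKG_eq_zero hb hbc_res hAd hA hcKG]
  exact ⟨rfl, CKG.eventually_argmaxSet_subset fun x => (hbm x).mul (hPF x)⟩
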